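/- Let $G$ be a connected finite simple graph with $n$ vertices and positive integer edge weights. The length of a walk is the number of edges it traverses and its weight is the sum of the weights of these edges, both counted with multiplicity. Let $W$ be the minimum weight of a closed walk in $G$ that contains all vertices of $G$. If $k$ is an integer and $T$ is a closed walk in $G$ of length $2n-2+k$ that contains all vertices of $G$, then the weight of $T$ is at least $W+k$. The bound is tight for even $k$: for every $n\ge 2$ and every even $k\ge 0$ (and also for $n=1$, $k=0$) there are a connected simple graph with $n$ vertices and positive integer edge weights, and a closed walk $T$ in it that has length $2n-2+k$, contains all vertices, and has weight exactly $W+k$, where $W$ is the minimum weight of a closed walk in that graph containing all vertices. -/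

import Mathlib

/-- The weight of a walk: the sum of the weights of the edges it traverses, each edge being
counted as many times as it is traversed. Only the values of `c` on edges of `G` matter. -/
def SimpleGraph.Walk.weightSum {V : Type*} {G : SimpleGraph V} {u v : V}
    (c : Sym2 V → ℕ) (p : G.Walk u v) : ℕ :=
  (p.edges.map c).sum

/-- A walk contains all vertices of the graph. -/
def SimpleGraph.Walk.VisitsAll {V : Type*} {G : SimpleGraph V} {u v : V}
    (p : G.Walk u v) : Prop :=
  ∀ x : V, x ∈ p.support

/-- The weights of the closed walks that contain all vertices of `G`. -/
def SimpleGraph.spanningClosedWalkWeights {V : Type*} (G : SimpleGraph V)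
    (c : Sym2 V → ℕ) : Set ℕ :=
  {w | ∃ (u : V) (p : G.Walk u u), p.VisitsAll ∧ p.weightSum c = w}

namespace SimpleGraph

variable {V : Type*} {G : SimpleGraph V}

/-! View a closed walk as an even connected multigraph of edges. With more than 2n - 2 edges, it has
at least n edges outside a spanning tree; these contain a nonempty even part, whose removal keeps
evenness and connectedness (`exists_even_connected_le`). What remains carries a spanning closed walk
by an Euler-type argument (`exists_visitsAll_edges_le`). Each removed edge weighs at least 1, which
gives the bound. Unit-weight stars attain it. -/

open Classical in
/-- Parity of the number of edges of a walk at a vertex, counted with multiplicity. -/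
theorem Walk.even_countP_edges_iff {u v : V} (p : G.Walk u v) (x : V) :
    Even ((p.edges : Multiset (Sym2 V)).countP (x ∈ ·)) ↔ (u ≠ v → x ≠ u ∧ x ≠ v) := by
  rw [Multiset.coe_countP]
  induction p with
  | nil => simp
  | cons huv p ih =>
    simp only [List.countP_cons, Ne, edges_cons, Sym2.mem_iff]
    have := huv.ne
    split_ifs with h
    · rw [decide_eq_true_eq] at h
      rw [Nat.even_add_one, ih]
      grind
    · grind

open Classical in
/-- If `x` and `y` are the only vertices of odd degree in a multigraph, then some walk inside it
joins them. -/
theorem exists_walk_edges_le_of_odd (M : Multiset (Sym2 V)) (hM : ∀ e ∈ M, e ∈ G.edgeSet)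
    {x y : V} (hxy : x ≠ y) (hodd : ∀ z, Even (M.countP (z ∈ ·)) ↔ z ≠ x ∧ z ≠ y) :
    ∃ p : G.Walk x y, (p.edges : Multiset (Sym2 V)) ≤ M := by
  induction hn : M.card generalizing M x with
  | zero =>
    have := hodd x
    simp_all
  | succ n ih =>
    have hx : 0 < M.countP (x ∈ ·) := by
      rw [Nat.pos_iff_ne_zero]
      intro h
      have := hodd x
      simp_all
    obtain ⟨e, he, hxe⟩ := Multiset.countP_pos.1 hx
    obtain ⟨z, rfl⟩ := Sym2.mem_iff_exists.1 hxe
    have hadj : G.Adj x z := hM _ he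
    obtain ⟨M, rfl⟩ := Multiset.exists_cons_of_mem he
    by_cases hzy : z = y
    · subst hzy
      exact ⟨hadj.toWalk, by simp⟩
    -- Deleting the edge flips parity at `x` and `z` only, so `z` and `y` are the odd vertices of
    -- the rest.
    · obtain ⟨p, hp⟩ := ih M (fun e h => hM e (Multiset.mem_cons_of_mem h)) hzy (fun w => by
        have h := hodd w
        have := hadj.ne
        rw [Multiset.countP_cons] at h
        simp only [Sym2.mem_iff] at h
        split_ifs at h <;> grind) (by simpa using hn)
      exact ⟨.cons hadj p, by simpa [← Multiset.cons_coe] using hp⟩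

open Classical in
/-- A connected multigraph with even degrees contains a spanning closed walk. -/
theorem exists_visitsAll_edges_le (M : Multiset (Sym2 V)) (hM : ∀ e ∈ M, e ∈ G.edgeSet)
    (heven : ∀ z, Even (M.countP (z ∈ ·))) (hconn : (fromEdgeSet {e | e ∈ M}).Connected) :
    ∃ (u : V) (p : G.Walk u u), p.VisitsAll ∧ (p.edges : Multiset (Sym2 V)) ≤ M := by
  -- Induction on the number of edges not yet used by the closed walk.
  suffices H : ∀ (n : ℕ) (u : V) (p : G.Walk u u), (p.edges : Multiset (Sym2 V)) ≤ M →
      M.card - p.length = n →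
      ∃ (u : V) (p : G.Walk u u), p.VisitsAll ∧ (p.edges : Multiset (Sym2 V)) ≤ M by
    obtain ⟨u⟩ := hconn.nonempty
    exact H _ u .nil (by simp) rfl
  intro n
  induction n using Nat.strong_induction_on with
  | _ n ih =>
    intro u p hp hn
    by_cases hall : p.VisitsAll
    · exact ⟨u, p, hall, hp⟩
    simp only [Walk.VisitsAll, not_forall] at hall
    obtain ⟨w, hw⟩ := hall
    obtain ⟨q⟩ := hconn.preconnected u w
    obtain ⟨⟨⟨x, y⟩, hd⟩, -, hx, hy⟩ :=
      q.exists_boundary_dart {z | z ∈ p.support} p.start_mem_support hw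
    simp only [Set.mem_ofPred_eq] at hx hy
    obtain ⟨hxyM, hxy⟩ := (fromEdgeSet_adj _).1 hd
    simp only [Set.mem_ofPred_eq] at hxyM
    have hadj : G.Adj x y := hM _ hxyM
    set c := p.rotate x hx
    have hc : (c.edges : Multiset (Sym2 V)) = p.edges :=
      Multiset.coe_eq_coe.2 (p.rotate_edges x hx).perm
    obtain ⟨R, rfl⟩ := Multiset.le_iff_exists_add.1 hp
    have hyp : s(x, y) ∉ (p.edges : Multiset (Sym2 V)) := fun h =>
      hy (p.snd_mem_support_of_mem_edges h)
    have hR : s(x, y) ∈ R := (Multiset.mem_add.1 hxyM).resolve_left hyp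
    obtain ⟨R, rfl⟩ := Multiset.exists_cons_of_mem hR
    -- Without `p` and the edge leaving its support, exactly `x` and `y` are odd, so unused edges
    -- lead from `y` back to `x`.
    obtain ⟨r, hr⟩ := exists_walk_edges_le_of_odd (G := G) R
      (fun e h => hM e (by simp [h])) hxy.symm (fun z => by
        have h1 := heven z
        have h2 : Even ((p.edges : Multiset (Sym2 V)).countP (z ∈ ·)) :=
          (p.even_countP_edges_iff z).2 (by simp)
        rw [Multiset.countP_add, Nat.even_add, Multiset.countP_cons] at h1
        simp only [Sym2.mem_iff] at h1
        split_ifs at h1 <;> grind)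
    have hlen : c.length = p.length := by
      simpa using congrArg Multiset.card hc
    have hrc := Multiset.card_le_card hr
    refine ih _ ?_ x (c.append (.cons hadj r)) ?_ rfl
    · simp only [Multiset.card_add, Multiset.coe_card, Walk.length_edges, Multiset.card_cons,
        Walk.length_append, Walk.length_cons] at *
      omega
    · rw [Walk.edges_append, ← Multiset.coe_add, hc, Walk.edges_cons, ← Multiset.cons_coe]
      gcongr
      exact Multiset.cons_le_cons _ hr

open Classical in
/-- A multigraph with at least as many edges as vertices contains a nonempty even multigraph. -/
theorem exists_even_le_of_card_le [Fintype V] [Nonempty V] (M : Multiset (Sym2 V))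
    (hM : ∀ e ∈ M, e ∈ G.edgeSet) (hcard : Fintype.card V ≤ M.card) :
    ∃ C ≤ M, C ≠ 0 ∧ ∀ z, Even (C.countP (z ∈ ·)) := by
  by_cases hnd : M.Nodup
  · have hcyc : ¬ (fromEdgeSet {e | e ∈ M}).IsAcyclic := by
      -- A forest extends to a spanning tree, which has only n - 1 edges.
      intro hac
      obtain ⟨F, hF, -, hFt⟩ := connected_top.exists_isTree_le_of_le_of_isAcyclic le_top hac
      have h1 := hFt.card_edgeFinset
      have h2 : (⟨M, hnd⟩ : Finset (Sym2 V)) ⊆ F.edgeFinset := by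
        intro e he
        rw [mem_edgeFinset]
        apply edgeSet_mono hF
        rw [edgeSet_fromEdgeSet]
        exact ⟨he, G.not_isDiag_of_mem_edgeSet (hM e he)⟩
      have h3 := Finset.card_le_card h2
      simp only [Finset.card_mk] at h3
      omega
    simp only [IsAcyclic, not_forall, not_not] at hcyc
    obtain ⟨v, c, hc⟩ := hcyc
    refine ⟨c.edges, ?_, ?_, fun z => (c.even_countP_edges_iff z).2 (by simp)⟩
    · refine (Multiset.le_iff_subset (Multiset.coe_nodup.2 hc.edges_nodup)).2 fun e he => ?_
      have := c.edges_subset_edgeSet he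
      rw [edgeSet_fromEdgeSet] at this
      exact this.1
    · rw [Ne, Multiset.coe_eq_zero, Walk.edges_eq_nil]
      exact hc.not_nil
  -- A repeated edge, taken twice, is even.
  · obtain ⟨e, he⟩ : ∃ e, e ::ₘ e ::ₘ 0 ≤ M := by
      simpa [Multiset.nodup_iff_le] using hnd
    exact ⟨_, he, by simp, fun z => by
      rw [Multiset.countP_cons, Multiset.countP_cons, Multiset.countP_zero]
      split_ifs <;> decide⟩

open Classical in
/-- A connected even multigraph contains one with at most `2n - 2` edges. -/
theorem exists_even_connected_le [Fintype V] (M : Multiset (Sym2 V))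
    (hM : ∀ e ∈ M, e ∈ G.edgeSet) (heven : ∀ z, Even (M.countP (z ∈ ·)))
    (hconn : (fromEdgeSet {e | e ∈ M}).Connected) :
    ∃ N ≤ M, (∀ z, Even (N.countP (z ∈ ·))) ∧ (fromEdgeSet {e | e ∈ N}).Connected ∧
      N.card + 2 ≤ 2 * Fintype.card V := by
  have := hconn.nonempty
  induction hn : M.card using Nat.strong_induction_on generalizing M with
  | _ n ih =>
    by_cases hcard : M.card + 2 ≤ 2 * Fintype.card V
    · exact ⟨M, le_rfl, heven, hconn, hcard⟩
    obtain ⟨F, hF, hFt⟩ := hconn.exists_isTree_le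
    have hFc := hFt.card_edgeFinset
    have hFM : F.edgeFinset.val ≤ M := by
      refine (Multiset.le_iff_subset F.edgeFinset.nodup).2 fun e he => ?_
      have := edgeSet_mono hF (mem_edgeFinset.1 he)
      rw [edgeSet_fromEdgeSet] at this
      exact this.1
    obtain ⟨R, rfl⟩ := Multiset.le_iff_exists_add.1 hFM
    obtain ⟨C, hCR, hC0, hC⟩ := exists_even_le_of_card_le (G := G) R
      (fun e h => hM e (by simp [h])) (by
        simp only [Multiset.card_add, Finset.card_val] at hcard
        omega)
    obtain ⟨S, rfl⟩ := Multiset.le_iff_exists_add.1 hCR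
    have hle : F.edgeFinset.val + S ≤ F.edgeFinset.val + (C + S) := by
      gcongr
      exact Multiset.le_add_left _ _
    have hCpos := Multiset.card_pos.2 hC0
    obtain ⟨N, hN, h⟩ := ih (F.edgeFinset.val + S).card (by
        simp only [Multiset.card_add] at *
        omega) (F.edgeFinset.val + S) (fun e h => hM e (Multiset.mem_of_le hle h))
      (fun z => by
        have h1 := heven z
        have h2 := hC z
        simp only [Multiset.countP_add] at *
        grind)
      (hFt.connected.mono fun a b hab => by
        simp only [fromEdgeSet_adj, Set.mem_ofPred_eq, Multiset.mem_add]
        exact ⟨.inl (mem_edgeFinset.2 hab), hab.ne⟩) rfl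
    exact ⟨N, hN.trans hle, h⟩

theorem Walk.VisitsAll.connected_fromEdgeSet {u v : V} {p : G.Walk u v} (hp : p.VisitsAll) :
    (fromEdgeSet {e | e ∈ p.edges}).Connected := by
  have : Nonempty V := ⟨u⟩
  have h : ∀ x, (fromEdgeSet {e | e ∈ p.edges}).Reachable u x := by
    classical
    intro x
    refine ⟨(p.takeUntil x (hp x)).transfer _ fun e he => ?_⟩
    rw [edgeSet_fromEdgeSet]
    exact ⟨p.edges_takeUntil_subset_edges (hp x) he,
      G.not_isDiag_of_mem_edgeSet (Walk.edges_subset_edgeSet _ he)⟩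
  exact ⟨fun x y => (h x).symm.trans (h y)⟩

/-- Every spanning closed walk can be replaced by one which is lighter by at least the excess of
its length over `2n - 2`. -/
theorem Walk.VisitsAll.exists_lighter [Fintype V] {c : Sym2 V → ℕ}
    (hc : ∀ e ∈ G.edgeSet, 0 < c e) {u : V} {T : G.Walk u u} (hT : T.VisitsAll) :
    ∃ w ∈ G.spanningClosedWalkWeights c, w + T.length + 2 ≤ T.weightSum c + 2 * Fintype.card V := by
  classical
  have hTG : ∀ e ∈ (T.edges : Multiset (Sym2 V)), e ∈ G.edgeSet :=
    fun e he => T.edges_subset_edgeSet he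
  obtain ⟨N, hN, heven, hconn, hcard⟩ := exists_even_connected_le (G := G) T.edges hTG
    (fun z => (T.even_countP_edges_iff z).2 (by simp)) hT.connected_fromEdgeSet
  obtain ⟨v, p, hp, hpN⟩ :=
    exists_visitsAll_edges_le N (fun e he => hTG e (Multiset.mem_of_le hN he)) heven hconn
  refine ⟨p.weightSum c, ⟨v, p, hp, rfl⟩, ?_⟩
  obtain ⟨S, hS⟩ := Multiset.le_iff_exists_add.1 hN
  obtain ⟨Q, rfl⟩ := Multiset.le_iff_exists_add.1 hpN
  have hw : T.weightSum c = p.weightSum c + (Q.map c).sum + (S.map c).sum := by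
    simpa [Walk.weightSum] using congrArg (fun M => (M.map c).sum) hS
  have hl : T.length = p.length + Q.card + S.card := by
    simpa using congrArg Multiset.card hS
  have hSc : S.card ≤ (S.map c).sum := by
    have := Multiset.card_nsmul_le_sum (s := S.map c) (a := 1) fun x hx => by
      obtain ⟨e, he, rfl⟩ := Multiset.mem_map.1 hx
      exact hc e (hTG e (by rw [hS]; simp [he]))
    simpa using this
  simp only [Multiset.card_add, Multiset.coe_card, Walk.length_edges] at hcard
  omega

theorem Walk.weightSum_one {u v : V} (p : G.Walk u v) : p.weightSum (fun _ => 1) = p.length := by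
  simp [Walk.weightSum]

/-- A spanning closed walk of a star on `n` vertices has length at least `2n - 2`. -/
theorem Walk.VisitsAll.two_mul_card_le_length_starGraph [Fintype V] {r u : V}
    {p : (starGraph r).Walk u u} (hp : p.VisitsAll) :
    2 * Fintype.card V ≤ p.length + 2 := by
  classical
  -- Each edge of a star has exactly one end other than the center.
  have key : ∀ l : List (Sym2 V), (∀ e ∈ l, e ∈ (starGraph r).edgeSet) →
      ∑ v ∈ Finset.univ.erase r, (l : Multiset (Sym2 V)).countP (v ∈ ·) = l.length := by
    intro l
    induction l with
    | nil => simp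
    | cons e l ih =>
      intro h
      have hone : ∑ v ∈ Finset.univ.erase r, (if v ∈ e then 1 else 0) = 1 := by
        have he := h e (by simp)
        induction e using Sym2.ind with
        | _ a b =>
          obtain ⟨hab, rfl | rfl⟩ := starGraph_adj.1 ((starGraph r).mem_edgeSet.1 he)
          · rw [Finset.sum_eq_single b] <;> simp +contextual [hab.symm]
          · rw [Finset.sum_eq_single a] <;> simp +contextual [hab]
      simp only [← Multiset.cons_coe, Multiset.countP_cons, Finset.sum_add_distrib, hone,
        ih fun e he => h e (by simp [he]), List.length_cons]
  rcases Nat.lt_or_ge (Fintype.card V) 2 with hV | hV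
  · omega
  have : Nontrivial V := Fintype.one_lt_card_iff_nontrivial.1 hV
  have h2 : ∀ v ∈ Finset.univ.erase r, 2 ≤ (p.edges : Multiset (Sym2 V)).countP (v ∈ ·) := by
    intro v _
    have hev := (p.even_countP_edges_iff v).2 (by simp)
    obtain ⟨w, hw⟩ := hp.connected_fromEdgeSet.preconnected.exists_adj_of_nontrivial v
    have hpos : 0 < (p.edges : Multiset (Sym2 V)).countP (v ∈ ·) :=
      Multiset.countP_pos.2 ⟨s(v, w), ((fromEdgeSet_adj _).1 hw).1, by simp⟩
    obtain ⟨t, ht⟩ := hev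
    omega
  have h := Finset.card_nsmul_le_sum _ _ 2 h2
  rw [key _ fun e he => p.edges_subset_edgeSet he, Finset.card_erase_of_mem (Finset.mem_univ r),
    Finset.card_univ, Walk.length_edges, smul_eq_mul] at h
  omega

/-- The closed walk in a star that goes to the given leaves one after another. -/
theorem exists_walk_starGraph (r : V) (l : List V) (hl : ∀ x ∈ l, x ≠ r) :
    ∃ p : (starGraph r).Walk r r, (∀ x ∈ l, x ∈ p.support) ∧ p.length = 2 * l.length := by
  induction l with
  | nil => exact ⟨.nil, by simp⟩
  | cons a l ih =>
    obtain ⟨p, hp, hlen⟩ := ih fun x hx => hl x (by simp [hx])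
    have ha : r ≠ a := (hl a (by simp)).symm
    refine ⟨.cons (starGraph_center_adj ha) (.cons (starGraph_center_adj' ha) p), ?_, ?_⟩
    · intro x hx
      rcases List.mem_cons.1 hx with rfl | hx
      · simp
      · simp [hp x hx]
    · simp only [Walk.length_cons, List.length_cons, hlen]
      ring

/-- Stars have spanning closed walks of all even lengths from `2n - 2` on. -/
theorem exists_visitsAll_starGraph [Fintype V] (r : V) (j : ℕ)
    (hj : Fintype.card V = 1 → j = 0) :
    ∃ p : (starGraph r).Walk r r, p.VisitsAll ∧ p.length + 2 = 2 * Fintype.card V + 2 * j := by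
  classical
  -- The surplus 2j comes from j further trips to a single leaf.
  obtain ⟨l, hl, hlen⟩ : ∃ l : List V, (∀ x ∈ l, x ≠ r) ∧ l.length = j := by
    rcases Nat.eq_zero_or_pos j with rfl | hpos
    · exact ⟨[], by simp⟩
    · have hV : 1 < Fintype.card V := by
        have := Fintype.card_pos_iff.2 ⟨r⟩
        omega
      have := Fintype.one_lt_card_iff_nontrivial.1 hV
      obtain ⟨a, ha⟩ := exists_ne r
      exact ⟨List.replicate j a, fun x hx => by rwa [List.eq_of_mem_replicate hx], by simp⟩
  obtain ⟨p, hp, hplen⟩ := exists_walk_starGraph r ((Finset.univ.erase r).toList ++ l) (by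
    intro x hx
    rcases List.mem_append.1 hx with hx | hx
    · simpa using hx
    · exact hl x hx)
  refine ⟨p, fun x => ?_, ?_⟩
  · by_cases hx : x = r
    · subst hx
      exact p.start_mem_support
    · exact hp x (by simp [hx])
  · have := Fintype.card_pos_iff.2 ⟨r⟩
    rw [List.length_append, Finset.length_toList, Finset.card_erase_of_mem (Finset.mem_univ r),
      Finset.card_univ] at hplen
    omega

end SimpleGraph

theorem mainTheorem5 :
    -- the lower bound
    (∀ (V : Type*) [Fintype V] (G : SimpleGraph V) (c : Sym2 V → ℕ) (k : ℤ) (W : ℕ)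
        (u : V) (T : G.Walk u u),
      G.Connected →
      (∀ e ∈ G.edgeSet, 0 < c e) →
      IsLeast (G.spanningClosedWalkWeights c) W →
      T.VisitsAll →
      (T.length : ℤ) = 2 * (Fintype.card V : ℤ) - 2 + k →
      (W : ℤ) + k ≤ (T.weightSum c : ℤ)) ∧
    -- its tightness
    (∀ n k : ℕ, 1 ≤ n → (n = 1 → k = 0) → Even k →
      ∃ (G : SimpleGraph (Fin n)) (c : Sym2 (Fin n) → ℕ) (W : ℕ)
        (u : Fin n) (T : G.Walk u u),
        G.Connected ∧
        (∀ e ∈ G.edgeSet, 0 < c e) ∧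
        IsLeast (G.spanningClosedWalkWeights c) W ∧
        T.VisitsAll ∧
        (T.length : ℤ) = 2 * (n : ℤ) - 2 + (k : ℤ) ∧
        T.weightSum c = W + k) := by
  refine ⟨fun V _ G c k W u T _ hc hW hT hlen => ?_, fun n k hn hn1 hk => ?_⟩
  · obtain ⟨w, hw, hle⟩ := hT.exists_lighter hc
    have := hW.2 hw
    omega
  · obtain ⟨j, rfl⟩ := hk
    have : NeZero n := ⟨by omega⟩
    obtain ⟨p, hp, hplen⟩ := SimpleGraph.exists_visitsAll_starGraph (0 : Fin n) 0 (by simp)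
    obtain ⟨T, hT, hTlen⟩ := SimpleGraph.exists_visitsAll_starGraph (0 : Fin n) j (by
      rw [Fintype.card_fin]
      omega)
    rw [Fintype.card_fin] at hplen hTlen
    refine ⟨SimpleGraph.starGraph 0, fun _ => 1, p.length, 0, T,
      SimpleGraph.connected_starGraph 0, fun _ _ => Nat.one_pos, ⟨⟨0, p, hp, p.weightSum_one⟩, ?_⟩,
      hT, ?_, ?_⟩
    · rintro _ ⟨u, q, hq, rfl⟩
      have := hq.two_mul_card_le_length_starGraph
      rw [Fintype.card_fin] at this
      rw [q.weightSum_one]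
      omega
    · omega
    · rw [T.weightSum_one]
      omega
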